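/- Let $\Sigma^+\neq\emptyset$ be a one-sided subshift of finite type over a finite alphabet, i.e. the set of all sequences $x=(x_0,x_1,\dots)$ in which no word (pattern) from a given finite list occurs, and let $\sigma:\Sigma^+\to\Sigma^+$, $(\sigma x)_k=x_{k+1}$, be the shift. Assume that $\sigma$ is topologically mixing. Fix $0<\lambda<1$ and endow $\Sigma^+$ with the metric $d(x,y)=\lambda^{n}$, $n=\min\{k\ge 0 : x_k\ne y_k\}$, for $x\neq y$. Fix $0<\alpha\le 1$. For $\gamma>0$ let $C^\gamma(\Sigma^+,\mathbb R)$ be the space of $\gamma$-Hölder functions $A:\Sigma^+\to\mathbb R$ with the norm $$\|A\|_\gamma=\sup_{x\ne y}\frac{|A(x)-A(y)|}{d(x,y)^\gamma}+\sup_{x}|A(x)| ,$$ let $C^\gamma_0\subseteq C^\gamma(\Sigma^+,\mathbb R)$ be the subset of functions with topological pressure $P(A)=0$, and let $C^{\alpha+}_0$ be the closure of $\bigcup_{\gamma>\alpha}C^\gamma_0$ in $C^\alpha(\Sigma^+,\mathbb R)$, with the topology of $\|\cdot\|_\alpha$. Here $$P(A)=\lim_{n\to\infty}\frac1n\log\sum_{w}\exp\Big(\sup_{x\in[w]}\sum_{k=0}^{n-1}A(\sigma^kx)\Big),$$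 the sum being over the words $w$ of length $n$ whose cylinder $[w]=\{x\in\Sigma^+ : x_0\cdots x_{n-1}=w\}$ is non-empty. A maximizing measure for $A$ is a $\sigma$-invariant Borel probability measure $\mu$ such that $\int A\,d\mu\ge\int A\,d\nu$ for every $\sigma$-invariant Borel probability measure $\nu$. **Theorem C.** There is a dense subset $\mathcal D\subseteq C^{\alpha+}_0$ such that every $A\in\mathcal D$ has a unique maximizing measure $\mu$, and the pair $(A,\mu)$ has the continuously varying support property: whenever $A_n\in C^\alpha_0$ converge to $A$ in the norm $\|\cdot\|_\alpha$ and $\mu_n$ is a maximizing measure for $A_n$ for each $n$, then $\mu_n\to\mu$ in the weak* topology and $\operatorname{supp}(\mu_n)\to\operatorname{supp}(\mu)$ in the Hausdorff metric. -/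

import Mathlib

open MeasureTheory Filter Topology
open scoped NNReal ENNReal BoundedContinuousFunction

noncomputable section

/-! ## One-sided subshifts of finite type -/

/-- The one-sided subshift of finite type over the alphabet `S` given by the finite set `F` of
forbidden patterns: all sequences `x₀ x₁ x₂ …` in which no pattern of `F` occurs at any position.
The parameter `lam ∈ (0,1)` only enters through the metric. -/
def SFT {S : Type*} [Inhabited S] (F : Finset (SymbolicDynamics.FullShift.Pattern S ℕ))
    (_lam : Set.Ioo (0 : ℝ) 1) : Type _ :=
  {x : ℕ → S // x ∈ SymbolicDynamics.FullShift.forbidden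
    (F : Set (SymbolicDynamics.FullShift.Pattern S ℕ))}

namespace SFT

variable {S : Type*} [Inhabited S] {F : Finset (SymbolicDynamics.FullShift.Pattern S ℕ)}
  {lam : Set.Ioo (0 : ℝ) 1}

open scoped Classical in
/-- The metric `d(x, y) = lam ^ n`, where `n = min {k | x k ≠ y k}` (and `d(x, x) = 0`). -/
instance : MetricSpace (SFT F lam) where
  dist x y := if x = y then 0 else (lam : ℝ) ^ PiNat.firstDiff x.1 y.1
  dist_self x := by simp
  dist_comm x y := by
    simp only [eq_comm (a := x) (b := y), PiNat.firstDiff_comm x.1 y.1]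
  dist_triangle x y z := by
    have h0 : (0 : ℝ) < lam := lam.2.1
    have h1 : (lam : ℝ) ≤ 1 := lam.2.2.le
    by_cases hxz : x = z
    · simp only [hxz, if_true]
      positivity
    by_cases hxy : x = y
    · simp [hxy]
    by_cases hyz : y = z
    · simp [hyz]
    have hne : x.1 ≠ z.1 := fun h => hxz (Subtype.ext h)
    simp only [hxz, hxy, hyz, if_false]
    rcases min_le_iff.1 (PiNat.min_firstDiff_le x.1 y.1 z.1 hne) with h | h
    · have := pow_le_pow_of_le_one h0.le h1 h
      have : 0 < (lam : ℝ) ^ PiNat.firstDiff y.1 z.1 := by positivity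
      linarith
    · have := pow_le_pow_of_le_one h0.le h1 h
      have : 0 < (lam : ℝ) ^ PiNat.firstDiff x.1 y.1 := by positivity
      linarith
  eq_of_dist_eq_zero {x y} h := by
    by_contra hxy
    have h0 : (0 : ℝ) < lam := lam.2.1
    have h1 : (lam : ℝ) ^ PiNat.firstDiff x.1 y.1 = 0 := by simpa [hxy] using h
    exact (pow_pos h0 _).ne' h1

instance : MeasurableSpace (SFT F lam) := borel _

instance : BorelSpace (SFT F lam) := ⟨rfl⟩

/-- The shift map `σ (x₀, x₁, x₂, …) = (x₁, x₂, …)`. -/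
def shift (x : SFT F lam) : SFT F lam :=
  ⟨fun n => x.1 (n + 1), fun p hp g hocc => x.2 p hp (g + 1) fun h hh => by
    have := hocc h hh
    rwa [Nat.add_right_comm g 1 h]⟩

/-- The cylinder of all points of the subshift that begin with the word `w`. -/
def cylinder {n : ℕ} (w : Fin n → S) : Set (SFT F lam) := {x | ∀ i : Fin n, x.1 i = w i}

open scoped Classical in
/-- The `n`-th partition function `∑_w exp (sup_{x ∈ [w]} ∑_{k < n} A (σ^k x))`, the sum being over
all words `w` of length `n` whose cylinder `[w]` is not empty. -/
def partitionFunction [Fintype S] (A : SFT F lam → ℝ) (n : ℕ) : ℝ :=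
  ∑ w : Fin n → S with (cylinder w : Set (SFT F lam)).Nonempty,
    Real.exp (sSup ((fun x => birkhoffSum shift A n x) '' cylinder w))

/-- The topological pressure `P(A) = lim_n (1/n) log Z_n(A)` of a continuous function `A`
(the limit exists, by subadditivity). -/
def pressure [Fintype S] (A : SFT F lam → ℝ) : ℝ :=
  limsup (fun n : ℕ => Real.log (partitionFunction A n) / n) atTop

end SFT

/-- Topological mixing of a map. -/
def IsTopologicallyMixing {X : Type*} [TopologicalSpace X] (f : X → X) : Prop :=
  ∀ U V : Set X, IsOpen U → IsOpen V → U.Nonempty → V.Nonempty →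
    ∃ N : ℕ, ∀ n ≥ N, (U ∩ f^[n] ⁻¹' V).Nonempty

/-! ## Hölder functions -/

/-- The bounded continuous functions that are `α`-Hölder. (If `α > 0` and `X` is bounded, every
`α`-Hölder function is bounded and continuous.) -/
def holderSubmodule (X : Type*) [MetricSpace X] (α : ℝ≥0) : Submodule ℝ (X →ᵇ ℝ) where
  carrier := {f | MemHolder α f}
  add_mem' hf hg := MemHolder.add hf hg
  zero_mem' := memHolder_zero
  smul_mem' _ _ hf := MemHolder.smul hf

/-- The space `C^α(X, ℝ)` of `α`-Hölder functions; its topology is that of the Hölder norm. -/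
def HolderSpace (X : Type*) [MetricSpace X] (α : ℝ≥0) : Type _ := holderSubmodule X α

namespace HolderSpace

variable {X : Type*} [MetricSpace X] {α : ℝ≥0}

instance : AddCommGroup (HolderSpace X α) := inferInstanceAs (AddCommGroup (holderSubmodule X α))

instance : Module ℝ (HolderSpace X α) := inferInstanceAs (Module ℝ (holderSubmodule X α))

instance : CoeFun (HolderSpace X α) fun _ => X → ℝ := ⟨fun A => A.1⟩

/-- The norm `‖A‖_α = Hold_α(A) + ‖A‖₀`, where `‖A‖₀` is the supremum norm and `Hold_α(A)` the
least Hölder constant of `A`. -/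
instance : NormedAddCommGroup (HolderSpace X α) :=
  AddGroupNorm.toNormedAddCommGroup
    { toFun := fun A => (nnHolderNorm α A : ℝ) + ‖A.1‖
      map_zero' := by
        have h : nnHolderNorm α (0 : X → ℝ) = 0 := nnHolderNorm_zero _ α
        have h' : (nnHolderNorm α (0 : X → ℝ) : ℝ) + ‖(0 : X →ᵇ ℝ)‖ = 0 := by simp [h]
        exact h'
      add_le' := fun A B => by
        have h1 : (nnHolderNorm α ((A : X → ℝ) + (B : X → ℝ)) : ℝ) ≤
            nnHolderNorm α (A : X → ℝ) + nnHolderNorm α (B : X → ℝ) := by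
          exact_mod_cast MemHolder.nnHolderNorm_add_le A.2 B.2
        have h2 : ‖A.1 + B.1‖ ≤ ‖A.1‖ + ‖B.1‖ := norm_add_le _ _
        have h3 : (nnHolderNorm α ((A : X → ℝ) + (B : X → ℝ)) : ℝ) + ‖A.1 + B.1‖ ≤
            (nnHolderNorm α (A : X → ℝ) + ‖A.1‖) + (nnHolderNorm α (B : X → ℝ) + ‖B.1‖) := by
          linarith
        exact h3
      neg' := fun A => by
        have h1 : nnHolderNorm α ((-1 : ℝ) • (A : X → ℝ)) = nnHolderNorm α (A : X → ℝ) := by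
          rw [MemHolder.nnHolderNorm_smul A.2]; simp
        rw [neg_one_smul] at h1
        have h2 : (nnHolderNorm α (-(A : X → ℝ)) : ℝ) + ‖-A.1‖ =
            nnHolderNorm α (A : X → ℝ) + ‖A.1‖ := by rw [h1, norm_neg]
        exact h2
      eq_zero_of_map_eq_zero' := fun A hA => by
        have h1 : (nnHolderNorm α (A : X → ℝ) : ℝ) + ‖A.1‖ = 0 := hA
        have h2 : ‖A.1‖ = 0 :=
          le_antisymm (by linarith [(nnHolderNorm α (A : X → ℝ)).coe_nonneg]) (norm_nonneg _)
        exact Subtype.ext (norm_eq_zero.1 h2) }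

end HolderSpace

section Maximizing

variable {S : Type*} [Fintype S] [Inhabited S]
  (F : Finset (SymbolicDynamics.FullShift.Pattern S ℕ)) (lam : Set.Ioo (0 : ℝ) 1) (α : ℝ≥0)

/-- `C^α_0`: the `α`-Hölder functions of zero topological pressure. -/
def zeroPressure : Set (HolderSpace (SFT F lam) α) := {A | SFT.pressure A = 0}

/-- `C^{α+}_0`: the closure, in the `α`-Hölder topology, of the union over `γ > α` of the sets
`C^γ_0`. -/
def zeroPressurePlus : Set (HolderSpace (SFT F lam) α) :=
  closure {A | SFT.pressure A = 0 ∧ ∃ γ : ℝ≥0, α < γ ∧ MemHolder γ A}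

variable {F lam α}

/-- `μ` is a maximizing measure for `A`: it is a shift invariant Borel probability and it maximizes
`∫ A dν` among all shift invariant Borel probabilities `ν`. -/
def IsMaximizingMeasure (A : SFT F lam → ℝ) (μ : ProbabilityMeasure (SFT F lam)) : Prop :=
  MeasurePreserving SFT.shift (μ : Measure (SFT F lam)) μ ∧
    ∀ ν : ProbabilityMeasure (SFT F lam),
      MeasurePreserving SFT.shift (ν : Measure (SFT F lam)) ν → ∫ x, A x ∂ν ≤ ∫ x, A x ∂μ

/-- Strong convergence of probability measures: weak* convergence, together with convergence of the
supports in the Hausdorff metric. -/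
def StronglyConverges {X : Type*} [MetricSpace X] [MeasurableSpace X] [BorelSpace X]
    (ν : ℕ → ProbabilityMeasure X) (μ : ProbabilityMeasure X) : Prop :=
  Tendsto ν atTop (𝓝 μ) ∧
    Tendsto (fun n => Metric.hausdorffEDist (ν n : Measure X).support (μ : Measure X).support)
      atTop (𝓝 0)

/-- The pair `(A, μ)` has the continuously varying support property: whenever `A n → A` in `C^α_0`
and `μ n` is a maximizing measure for `A n`, the sequence `μ n` converges strongly to `μ`. -/
def HasContinuouslyVaryingSupport (A : HolderSpace (SFT F lam) α)
    (μ : ProbabilityMeasure (SFT F lam)) : Prop :=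
  ∀ (An : ℕ → HolderSpace (SFT F lam) α) (μn : ℕ → ProbabilityMeasure (SFT F lam)),
    (∀ n, An n ∈ zeroPressure F lam α) → Tendsto An atTop (𝓝 A) →
    (∀ n, IsMaximizingMeasure (An n) (μn n)) → StronglyConverges μn μ

end Maximizing

end

/-!
A function in `C^γ` with `γ > α` is approximated in `C^α` by functions of finitely many
coordinates. For such a function, cutting repeated words out of an orbit segment shows that some
periodic orbit maximizes all Birkhoff sums up to a bounded error. Subtracting a small multiple of
the indicator function of the complement of a neighbourhood of this orbit makes each excursion from
the orbit costly: the function is locked on the orbit. Subtracting the pressure preserves this.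

A perturbation that is small in `C^α` gains at most a small amount per excursion, because an orbit
segment inside the neighbourhood shadows the periodic orbit exponentially well. So being locked is
an open condition: all nearby functions have the measure on the periodic orbit as their only
maximizing measure, and `μ_n` is even equal to `μ` for large `n`.
-/

section BirkhoffSum

variable {X : Type*} {T : X → X} {f g : X → ℝ} {b : ℝ} {p : X} {q : ℕ}

theorem birkhoffSum_le_birkhoffSum_add {c : ℝ} (h : ∀ x, f x ≤ g x + c) (n : ℕ) (x : X) :
    birkhoffSum T f n x ≤ birkhoffSum T g n x + n * c := by
  refine (Finset.sum_le_sum fun k _ => h (T^[k] x)).trans_eq ?_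
  simp [birkhoffSum, Finset.sum_add_distrib]

theorem abs_birkhoffSum_le (hg : ∀ x, |g x| ≤ b) (n : ℕ) (x : X) :
    |birkhoffSum T g n x| ≤ n * b := by
  refine (Finset.abs_sum_le_sum_abs _ _).trans ((Finset.sum_le_sum fun k _ => hg _).trans_eq ?_)
  simp

theorem natCast_mul_birkhoffAverage (g : X → ℝ) (n : ℕ) (x : X) :
    n * birkhoffAverage ℝ T g n x = birkhoffSum T g n x := by
  rcases eq_or_ne n 0 with rfl | hn
  · simp
  · rw [birkhoffAverage, smul_eq_mul, mul_inv_cancel_left₀ (Nat.cast_ne_zero.2 hn)]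

theorem abs_birkhoffAverage_le (hg : ∀ x, |g x| ≤ b) (n : ℕ) (x : X) :
    |birkhoffAverage ℝ T g n x| ≤ b := by
  rcases n.eq_zero_or_pos with rfl | hn
  · simpa using (abs_nonneg _).trans (hg x)
  · refine le_of_mul_le_mul_left ?_ (Nat.cast_pos (α := ℝ).2 hn)
    rw [← Nat.abs_cast n, ← abs_mul, natCast_mul_birkhoffAverage, Nat.abs_cast]
    exact abs_birkhoffSum_le hg n x

theorem birkhoffSum_iterate_of_isPeriodicPt (hp : Function.IsPeriodicPt T q p) (g : X → ℝ)
    (i : ℕ) : birkhoffSum T g q (T^[i] p) = birkhoffSum T g q p := by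
  induction i with
  | zero => rfl
  | succ i ih =>
    rw [Function.iterate_succ_apply', ← ih, ← sub_eq_zero, birkhoffSum_apply_sub_birkhoffSum,
      (hp.apply_iterate i).eq, sub_self]

theorem periodic_birkhoffSum_sub_mul_birkhoffAverage (hp : Function.IsPeriodicPt T q p)
    (g : X → ℝ) :
    Function.Periodic (fun n : ℕ => birkhoffSum T g n p - n * birkhoffAverage ℝ T g q p) q := by
  intro n
  dsimp only
  rw [add_comm n q, birkhoffSum_add, hp.eq, ← natCast_mul_birkhoffAverage g q]
  push_cast
  ring

theorem abs_birkhoffSum_sub_le_of_isPeriodicPt (hq : 0 < q) (hp : Function.IsPeriodicPt T q p)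
    (hg : ∀ x, |g x| ≤ b) (n : ℕ) :
    |birkhoffSum T g n p - n * birkhoffAverage ℝ T g q p| ≤ 2 * q * b := by
  rw [← (periodic_birkhoffSum_sub_mul_birkhoffAverage hp g).map_mod_nat n]
  have hb : 0 ≤ b := (abs_nonneg _).trans (hg p)
  have hmod : ((n % q : ℕ) : ℝ) * b ≤ q * b := by
    gcongr
    exact (Nat.mod_lt n hq).le
  have hsum := abs_birkhoffSum_le (T := T) hg (n % q) p
  have havg : |((n % q : ℕ) : ℝ) * birkhoffAverage ℝ T g q p| ≤ (n % q : ℕ) * b := by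
    rw [abs_mul, Nat.abs_cast]
    gcongr
    exact abs_birkhoffAverage_le hg q p
  refine (abs_sub _ _).trans ?_
  linarith

theorem abs_birkhoffSum_iterate_sub_le_of_isPeriodicPt (hq : 0 < q)
    (hp : Function.IsPeriodicPt T q p) (hg : ∀ x, |g x| ≤ b) (i n : ℕ) :
    |birkhoffSum T g n (T^[i] p) - n * birkhoffAverage ℝ T g q p| ≤ 2 * q * b := by
  have h := abs_birkhoffSum_sub_le_of_isPeriodicPt hq (hp.apply_iterate i) hg n
  rwa [birkhoffAverage, birkhoffSum_iterate_of_isPeriodicPt hp] at h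

theorem birkhoffSum_le_of_forall_notMem {V : Set X} {m R d : ℝ} (hg : ∀ x, g x ≤ m + d)
    (hrun : ∀ x n, (∀ k < n, T^[k] x ∉ V) → birkhoffSum T g n x ≤ n * m + R) (n : ℕ) (x : X) :
    birkhoffSum T g n x ≤ n * m + (R + d) * birkhoffSum T (V.indicator 1) n x + R := by
  have hzero {n x} (h : ∀ k < n, T^[k] x ∉ V) : birkhoffSum T (V.indicator (1 : X → ℝ)) n x = 0 :=
    Finset.sum_eq_zero fun k hk => Set.indicator_of_notMem (h k (Finset.mem_range.1 hk)) _
  induction n using Nat.strong_induction_on generalizing x with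
  | _ n ih =>
    by_cases hvisit : ∃ k < n, T^[k] x ∈ V
    · classical
      obtain ⟨hKn, hK⟩ := Nat.find_spec hvisit
      have hbefore : ∀ k < Nat.find hvisit, T^[k] x ∉ V := fun k hk hkV =>
        Nat.find_min hvisit hk ⟨hk.trans hKn, hkV⟩
      generalize Nat.find hvisit = K at hKn hK hbefore
      obtain ⟨l, rfl⟩ := Nat.exists_eq_add_of_le (Nat.succ_le_of_lt hKn)
      have hafter := ih l (by lia) (T^[K + 1] x)
      have hfirst := hrun x K hbefore
      have hK1 : V.indicator (1 : X → ℝ) (T^[K] x) = 1 := Set.indicator_of_mem hK _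
      rw [birkhoffSum_add, birkhoffSum_add, birkhoffSum_succ, birkhoffSum_succ, hzero hbefore, hK1]
      push_cast
      linarith [hg (T^[K] x)]
    · push Not at hvisit
      rw [hzero hvisit]
      linarith [hrun x n hvisit]

end BirkhoffSum

section InvariantMeasure

variable {X : Type*} [MeasurableSpace X] {T : X → X} {ν : Measure X} {f : X → ℝ}
  {c C : ℝ}

theorem integral_birkhoffSum (hT : MeasurePreserving T ν ν) (hf : Integrable f ν) (n : ℕ) :
    ∫ x, birkhoffSum T f n x ∂ν = n * ∫ x, f x ∂ν := by
  have hiterate (k : ℕ) : ∫ x, f (T^[k] x) ∂ν = ∫ x, f x ∂ν := by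
    have hk := (hT.iterate k).map_eq
    rw [← integral_map (hT.iterate k).aemeasurable (by rw [hk]; exact hf.1), hk]
  have hint (k : ℕ) : Integrable (fun x => f (T^[k] x)) ν :=
    (hT.iterate k).integrable_comp_of_integrable hf
  simp only [birkhoffSum]
  rw [integral_finsetSum _ fun k _ => hint k]
  simp [hiterate]

theorem integrable_birkhoffSum (hT : MeasurePreserving T ν ν) (hf : Integrable f ν) (n : ℕ) :
    Integrable (birkhoffSum T f n) ν :=
  integrable_finsetSum _ fun k _ => (hT.iterate k).integrable_comp_of_integrable hf

variable [IsProbabilityMeasure ν]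

theorem integral_le_of_birkhoffSum_le (hT : MeasurePreserving T ν ν) (hf : Integrable f ν)
    (h : ∀ n : ℕ, ∀ᵐ x ∂ν, birkhoffSum T f n x ≤ n * c + C) : ∫ x, f x ∂ν ≤ c := by
  have hn (n : ℕ) : n * ∫ x, f x ∂ν ≤ n * c + C := by
    rw [← integral_birkhoffSum hT hf]
    simpa using integral_mono_ae (integrable_birkhoffSum hT hf n) (integrable_const _) (h n)
  by_contra! hlt
  obtain ⟨n, hCn⟩ := exists_nat_gt (C / (∫ x, f x ∂ν - c))
  rw [div_lt_iff₀ (by linarith)] at hCn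
  linarith [hn n]

theorem integral_eq_of_abs_birkhoffSum_sub_le (hT : MeasurePreserving T ν ν)
    (hf : Integrable f ν) (h : ∀ n : ℕ, ∀ᵐ x ∂ν, |birkhoffSum T f n x - n * c| ≤ C) :
    ∫ x, f x ∂ν = c := by
  refine le_antisymm (integral_le_of_birkhoffSum_le (C := C) hT hf fun n => ?_) ?_
  · filter_upwards [h n] with x hx
    linarith [(abs_le.1 hx).2]
  · rw [← neg_le_neg_iff, ← integral_neg]
    refine integral_le_of_birkhoffSum_le (f := -f) (C := C) hT hf.neg fun n => ?_
    filter_upwards [h n] with x hx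
    rw [birkhoffSum_neg]
    linarith [(abs_le.1 hx).1]

theorem integral_add_mul_measureReal_le_of_birkhoffSum_le (hT : MeasurePreserving T ν ν)
    (hf : Integrable f ν) {V : Set X} (hV : MeasurableSet V) {ε : ℝ}
    (h : ∀ n x, birkhoffSum T f n x ≤ n * c - ε * birkhoffSum T (V.indicator 1) n x + C) :
    ∫ x, f x ∂ν + ε * ν.real V ≤ c := by
  have hε : Integrable (ε • V.indicator (1 : X → ℝ)) ν :=
    ((integrable_const (1 : ℝ)).indicator hV).smul ε
  have hint : ∫ x, (f + ε • V.indicator (1 : X → ℝ)) x ∂ν = ∫ x, f x ∂ν + ε * ν.real V := by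
    rw [integral_add' hf hε, ← integral_indicator_one hV, ← integral_const_mul]
    rfl
  rw [← hint]
  refine integral_le_of_birkhoffSum_le (C := C) hT (hf.add hε) fun n => .of_forall fun x => ?_
  have hsmul : birkhoffSum T (ε • V.indicator (1 : X → ℝ)) n x =
      ε * birkhoffSum T (V.indicator 1) n x := by
    simp [birkhoffSum, Finset.mul_sum]
  rw [birkhoffSum_add', hsmul]
  linarith [h n x]

end InvariantMeasure

section OrbitMeasure

variable {X : Type*} [MeasurableSpace X] {T : X → X} {p : X} {q : ℕ}

/-- The uniform distribution on the first `q` points of the orbit of `p` under `T`, used when `p`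
has period `q`. It is the zero measure for `q = 0`. -/
noncomputable def orbitMeasure (T : X → X) (p : X) (q : ℕ) : Measure X :=
  (q : ℝ≥0∞)⁻¹ • ∑ k ∈ Finset.range q, Measure.dirac (T^[k] p)

theorem isProbabilityMeasure_orbitMeasure (T : X → X) (p : X) (hq : 0 < q) :
    IsProbabilityMeasure (orbitMeasure T p q) := by
  refine ⟨?_⟩
  rw [orbitMeasure, Measure.smul_apply, Measure.finsetSum_apply]
  simp only [measure_univ, Finset.sum_const, Finset.card_range, nsmul_eq_mul, mul_one, smul_eq_mul]
  exact ENNReal.inv_mul_cancel (Nat.cast_ne_zero.2 hq.ne') (ENNReal.natCast_ne_top q)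

theorem measurePreserving_orbitMeasure (hT : Measurable T) (hp : Function.IsPeriodicPt T q p) :
    MeasurePreserving T (orbitMeasure T p q) (orbitMeasure T p q) := by
  refine ⟨hT, ?_⟩
  have hdirac (k : ℕ) : Measure.mapₗ T (Measure.dirac (T^[k] p)) = Measure.dirac (T^[k + 1] p) := by
    rw [Measure.mapₗ_apply_of_measurable hT, Measure.map_dirac' hT, Function.iterate_succ_apply']
  rw [orbitMeasure, Measure.map_smul, ← Measure.mapₗ_apply_of_measurable hT, map_sum]
  simp only [hdirac]
  rcases q with _ | q
  · simp
  · rw [Finset.sum_range_succ, hp.eq, Finset.sum_range_succ', Function.iterate_zero_apply]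

theorem integral_orbitMeasure [MeasurableSingletonClass X] (f : X → ℝ) :
    ∫ x, f x ∂(orbitMeasure T p q) = birkhoffAverage ℝ T f q p := by
  rw [orbitMeasure, integral_smul_measure,
    integral_finsetSum_measure fun k _ => integrable_dirac enorm_lt_top]
  simp [integral_dirac, birkhoffAverage, birkhoffSum]

theorem eq_orbitMeasure_of_ae_mem_orbit [MeasurableSingletonClass X] (hq : 0 < q)
    (hp : Function.IsPeriodicPt T q p) {ν : Measure X} [IsProbabilityMeasure ν]
    (hν : MeasurePreserving T ν ν) (h : ∀ᵐ x ∂ν, ∃ i, x = T^[i] p) : ν = orbitMeasure T p q := by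
  have := isProbabilityMeasure_orbitMeasure T p hq
  refine Measure.ext fun s hs => (measureReal_eq_measureReal_iff ..).1 ?_
  rw [← integral_indicator_one hs, ← integral_indicator_one hs, integral_orbitMeasure]
  have hbound (x : X) : |s.indicator (1 : X → ℝ) x| ≤ 1 := by
    by_cases hx : x ∈ s <;> simp [hx]
  refine integral_eq_of_abs_birkhoffSum_sub_le (C := 2 * q * 1) hν
    ((integrable_const _).indicator hs) fun n => ?_
  filter_upwards [h] with x ⟨i, hx⟩
  rw [hx]
  exact abs_birkhoffSum_iterate_sub_le_of_isPeriodicPt hq hp hbound i n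

end OrbitMeasure

section Holder

variable {X : Type*} [MetricSpace X] {f : X → ℝ} {C α γ : ℝ≥0} {r : ℝ}

theorem holderWith_of_abs_sub_le (h : ∀ x y, |f x - f y| ≤ C * dist x y ^ (γ : ℝ)) :
    HolderWith C γ f := by
  intro x y
  rw [edist_nndist, edist_nndist, ← ENNReal.coe_rpow_of_nonneg _ γ.coe_nonneg, ← ENNReal.coe_mul,
    ENNReal.coe_le_coe, ← NNReal.coe_le_coe, NNReal.coe_mul, NNReal.coe_rpow, coe_nndist,
    coe_nndist]
  exact h x y

theorem memHolder_of_eq_of_dist_le {b : ℝ} (hr : 0 < r) (hb : ∀ x, |f x| ≤ b)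
    (hf : ∀ x y, dist x y ≤ r → f x = f y) (γ : ℝ≥0) : MemHolder γ f := by
  rcases isEmpty_or_nonempty X with _ | ⟨⟨x₀⟩⟩
  · exact ⟨0, fun x => isEmptyElim x⟩
  have hb0 : 0 ≤ b := (abs_nonneg _).trans (hb x₀)
  have hrγ : 0 < r ^ (γ : ℝ) := Real.rpow_pos_of_pos hr _
  refine ⟨⟨2 * b / r ^ (γ : ℝ), by positivity⟩, holderWith_of_abs_sub_le fun x y => ?_⟩
  change |f x - f y| ≤ 2 * b / r ^ (γ : ℝ) * dist x y ^ (γ : ℝ)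
  rcases le_total (dist x y) r with hxy | hxy
  · rw [hf x y hxy, sub_self, abs_zero]
    positivity
  · calc |f x - f y| ≤ 2 * b := (abs_sub _ _).trans (by linarith [hb x, hb y])
      _ = 2 * b / r ^ (γ : ℝ) * r ^ (γ : ℝ) := (div_mul_cancel₀ _ hrγ.ne').symm
      _ ≤ 2 * b / r ^ (γ : ℝ) * dist x y ^ (γ : ℝ) := by gcongr

theorem abs_sub_le_of_holderWith (hf : HolderWith C γ f) (x y : X) :
    |f x - f y| ≤ C * dist x y ^ (γ : ℝ) := by
  rw [← Real.dist_eq]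
  exact hf.dist_le x y

variable {π : X → X}

theorem abs_comp_sub_le_of_dist_le (hf : HolderWith C γ f) (hπ : ∀ x, dist (π x) x ≤ r) (x : X) :
    |f (π x) - f x| ≤ C * r ^ (γ : ℝ) := by
  refine (abs_sub_le_of_holderWith hf _ _).trans ?_
  gcongr
  exact hπ x

/-- Points at distance at least `r` are handled by the sup bound, closer ones by `π x = π y`. -/
theorem holderWith_comp_sub (hr : 0 < r) (hαγ : α ≤ γ) (hf : HolderWith C γ f)
    (hπ : ∀ x, dist (π x) x ≤ r) (hπ' : ∀ x y, dist x y ≤ r → π x = π y) :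
    HolderWith (2 * C * r.toNNReal ^ ((γ : ℝ) - α)) α (fun x => f (π x) - f x) := by
  have hα : (0 : ℝ) ≤ α := α.coe_nonneg
  have hαγ' : (0 : ℝ) ≤ γ - α := sub_nonneg.2 hαγ
  refine holderWith_of_abs_sub_le fun x y => ?_
  push_cast
  rw [Real.coe_toNNReal r hr.le]
  rcases le_total (dist x y) r with hxy | hxy
  · rw [hπ' x y hxy, sub_sub_sub_cancel_left, abs_sub_comm]
    calc |f x - f y| ≤ C * dist x y ^ (γ : ℝ) := abs_sub_le_of_holderWith hf x y
      _ = C * (dist x y ^ ((γ : ℝ) - α) * dist x y ^ (α : ℝ)) := by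
        rw [← Real.rpow_add_of_nonneg dist_nonneg hαγ' hα, sub_add_cancel]
      _ ≤ C * (r ^ ((γ : ℝ) - α) * dist x y ^ (α : ℝ)) := by gcongr
      _ ≤ 2 * C * r ^ ((γ : ℝ) - α) * dist x y ^ (α : ℝ) := by
        have : 0 ≤ C * (r ^ ((γ : ℝ) - α) * dist x y ^ (α : ℝ)) := by positivity
        linarith
  · calc |f (π x) - f x - (f (π y) - f y)| ≤ |f (π x) - f x| + |f (π y) - f y| := abs_sub _ _
      _ ≤ C * r ^ (γ : ℝ) + C * r ^ (γ : ℝ) :=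
        add_le_add (abs_comp_sub_le_of_dist_le hf hπ x) (abs_comp_sub_le_of_dist_le hf hπ y)
      _ = 2 * C * r ^ ((γ : ℝ) - α) * r ^ (α : ℝ) := by
        rw [mul_assoc, ← Real.rpow_add hr, sub_add_cancel]
        ring
      _ ≤ 2 * C * r ^ ((γ : ℝ) - α) * dist x y ^ (α : ℝ) := by gcongr

end Holder

namespace HolderSpace

variable {X : Type*} [MetricSpace X] {α : ℝ≥0}

theorem norm_le (A : HolderSpace X α) {C : ℝ≥0} {b : ℝ} (hA : HolderWith C α A) (hb : 0 ≤ b)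
    (h : ∀ x, |A x| ≤ b) : ‖A‖ ≤ C + b :=
  add_le_add (NNReal.coe_le_coe.2 hA.nnholderNorm_le) ((BoundedContinuousFunction.norm_le hb).2 h)

theorem norm_coe_le_norm (A : HolderSpace X α) : ‖A.1‖ ≤ ‖A‖ :=
  le_add_of_nonneg_left (nnHolderNorm α (A : X → ℝ)).coe_nonneg

theorem abs_apply_le_norm (A : HolderSpace X α) (x : X) : |A x| ≤ ‖A‖ :=
  (A.1.norm_coe_le_norm x).trans A.norm_coe_le_norm

theorem abs_sub_apply_le (A : HolderSpace X α) (x y : X) :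
    |A x - A y| ≤ ‖A‖ * dist x y ^ (α : ℝ) := by
  refine (abs_sub_le_of_holderWith (MemHolder.holderWith A.2) x y).trans ?_
  gcongr
  exact le_add_of_nonneg_right (norm_nonneg A.1)

instance : NormedSpace ℝ (HolderSpace X α) where
  norm_smul_le c A := by
    calc ‖c • A‖ = (nnHolderNorm α (c • (A : X → ℝ)) : ℝ) + ‖c • A.1‖ := rfl
      _ = ‖c‖ * (nnHolderNorm α (A : X → ℝ) + ‖A.1‖) := by
        rw [MemHolder.nnHolderNorm_smul A.2, norm_smul, NNReal.coe_mul, coe_nnnorm, mul_add]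
      _ ≤ ‖c‖ * ‖A‖ := le_rfl

/-- The constant function `c`, as a Hölder function. -/
def const (X : Type*) [MetricSpace X] (α : ℝ≥0) (c : ℝ) : HolderSpace X α :=
  ⟨BoundedContinuousFunction.const X c, memHolder_const⟩

theorem norm_const_le (c : ℝ) : ‖const X α c‖ ≤ |c| := by
  simpa using norm_le (const X α c) (C := 0) HolderWith.const (abs_nonneg c) fun _ => le_rfl

/-- The Hölder function with underlying function `f`. -/
noncomputable def ofBounded (hα : 0 < α) {f : X → ℝ} (hf : MemHolder α f)
    (hb : ∃ b, ∀ x, |f x| ≤ b) : HolderSpace X α :=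
  ⟨BoundedContinuousFunction.ofNormedAddCommGroup f (hf.holderWith.continuous hα) hb.choose
    hb.choose_spec, hf⟩

end HolderSpace

theorem exists_repeated_word {S : Type*} [Fintype S] (x : ℕ → S) (N : ℕ) :
    ∃ i q, 0 < q ∧ i + q ≤ Fintype.card S ^ N ∧ ∀ r < N, x (i + r) = x (i + q + r) := by
  obtain ⟨a, c, hac, h⟩ := Fintype.exists_ne_map_eq_of_card_lt
    (fun (k : Fin (Fintype.card S ^ N + 1)) (r : Fin N) => x (k + r)) (by simp)
  wlog hlt : a < c generalizing a c
  · exact this c a hac.symm h.symm (hac.lt_or_gt.resolve_left hlt)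
  have hlt' : (a : ℕ) < c := hlt
  refine ⟨a, c - a, by lia, by lia, fun r hr => ?_⟩
  rw [Nat.add_sub_cancel' hlt'.le]
  exact congrFun h ⟨r, hr⟩

namespace SFT

variable {S : Type*} [Inhabited S] {F : Finset (SymbolicDynamics.FullShift.Pattern S ℕ)}
  {lam : Set.Ioo (0 : ℝ) 1}

section Metric

theorem ext_apply {x y : SFT F lam} (h : ∀ t, x.1 t = y.1 t) : x = y :=
  Subtype.ext (funext h)

theorem shift_iterate_apply (k : ℕ) (x : SFT F lam) (t : ℕ) :
    (shift^[k] x).1 t = x.1 (t + k) := by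
  induction k generalizing x with
  | zero => rfl
  | succ k ih =>
    rw [Function.iterate_succ_apply, ih]
    rfl

theorem periodic_apply {p : SFT F lam} {q : ℕ} (hp : Function.IsPeriodicPt shift q p) :
    Function.Periodic p.1 q := fun t => by
  rw [← shift_iterate_apply, hp.eq]

theorem dist_le_pow_iff (x y : SFT F lam) (N : ℕ) :
    dist x y ≤ (lam : ℝ) ^ N ↔ ∀ t < N, x.1 t = y.1 t := by
  have hlam : (0 : ℝ) < lam := lam.2.1
  rcases eq_or_ne x y with rfl | hxy
  · simp [hlam.le]
  have hdist : dist x y = (lam : ℝ) ^ PiNat.firstDiff x.1 y.1 := if_neg hxy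
  rw [hdist, pow_le_pow_iff_right_of_lt_one₀ hlam lam.2.2,
    ← PiNat.mem_cylinder_iff_le_firstDiff (Subtype.coe_injective.ne hxy)]
  rfl

theorem continuous_shift : Continuous (shift : SFT F lam → SFT F lam) := by
  refine Metric.continuous_iff.2 fun x ε hε => ?_
  obtain ⟨N, hN⟩ := exists_pow_lt_of_lt_one hε lam.2.2
  refine ⟨(lam : ℝ) ^ (N + 1), pow_pos lam.2.1 _, fun y hy => lt_of_le_of_lt ?_ hN⟩
  exact (dist_le_pow_iff _ _ N).2 fun t ht =>
    (dist_le_pow_iff y x (N + 1)).1 hy.le (t + 1) (by lia)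

theorem exists_cylinder_representative (N : ℕ) : ∃ π : SFT F lam → SFT F lam,
    (∀ x, dist (π x) x ≤ (lam : ℝ) ^ N) ∧ ∀ x y, dist x y ≤ (lam : ℝ) ^ N → π x = π y := by
  let word (x : SFT F lam) (i : Fin N) : S := x.1 i
  have hword (x y : SFT F lam) : dist x y ≤ (lam : ℝ) ^ N ↔ word x = word y := by
    rw [dist_le_pow_iff, funext_iff, Fin.forall_iff]
  refine ⟨fun x => Set.rangeSplitting word ⟨word x, x, rfl⟩, fun x => ?_, fun x y hxy => ?_⟩
  · exact (hword _ _).2 (Set.apply_rangeSplitting word _)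
  · simp only [(hword x y).1 hxy]

end Metric

section DependsOnFirst

/-- The function `f` depends only on the first `N` coordinates of a point. -/
def DependsOnFirst (N : ℕ) {β : Type*} (f : SFT F lam → β) : Prop :=
  ∀ x y : SFT F lam, (∀ t < N, x.1 t = y.1 t) → f x = f y

namespace DependsOnFirst

variable {N : ℕ}

theorem mono {β : Type*} {f : SFT F lam → β} (hf : DependsOnFirst N f) {M : ℕ} (h : N ≤ M) :
    DependsOnFirst M f :=
  fun x y hxy => hf x y fun t ht => hxy t (ht.trans_le h)

theorem eq_of_dist_le {β : Type*} {f : SFT F lam → β} (hf : DependsOnFirst N f) (x y : SFT F lam)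
    (h : dist x y ≤ (lam : ℝ) ^ N) : f x = f y :=
  hf x y ((dist_le_pow_iff x y N).1 h)

theorem isOpen {U : Set (SFT F lam)} (hU : DependsOnFirst N (· ∈ U)) : IsOpen U := by
  refine Metric.isOpen_iff.2 fun x hx => ⟨(lam : ℝ) ^ N, pow_pos lam.2.1 _, fun y hy => ?_⟩
  exact (hU.eq_of_dist_le y x (Metric.mem_ball.1 hy).le).mpr hx

theorem indicator_one {U : Set (SFT F lam)} (hU : DependsOnFirst N (· ∈ U)) :
    DependsOnFirst N (U.indicator (1 : SFT F lam → ℝ)) := fun x y h => by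
  classical
  simp only [Set.indicator_apply, hU x y h, Pi.one_apply]

theorem exists_abs_le [Finite S] {f : SFT F lam → ℝ} (hf : DependsOnFirst N f) :
    ∃ b, ∀ x, |f x| ≤ b := by
  obtain ⟨g, hg⟩ := (Function.factorsThrough_iff (f := fun (x : SFT F lam) (i : Fin N) => x.1 i)
    f).1 fun x y h => hf x y fun t ht => congrFun h ⟨t, ht⟩
  obtain ⟨b, hb⟩ := (Set.finite_range fun w => |g w|).bddAbove
  exact ⟨b, fun x => by rw [hg]; exact hb (Set.mem_range_self _)⟩

theorem memHolder [Finite S] {f : SFT F lam → ℝ} (hf : DependsOnFirst N f) (γ : ℝ≥0) :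
    MemHolder γ f := by
  obtain ⟨b, hb⟩ := hf.exists_abs_le
  exact memHolder_of_eq_of_dist_le (pow_pos lam.2.1 N) hb hf.eq_of_dist_le γ

theorem birkhoffSum_eq {β : Type*} [AddCommMonoid β] {f : SFT F lam → β}
    (hf : DependsOnFirst N f) {n : ℕ} {x y : SFT F lam} (h : ∀ t < n + N, x.1 t = y.1 t) :
    birkhoffSum shift f n x = birkhoffSum shift f n y := by
  refine Finset.sum_congr rfl fun k hk => hf _ _ fun t ht => ?_
  rw [shift_iterate_apply, shift_iterate_apply]
  exact h _ (by have := Finset.mem_range.1 hk; lia)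

variable {α : ℝ≥0}

/-- A function of finitely many coordinates over a finite alphabet, as a Hölder function. -/
noncomputable def toHolderSpace [Finite S] (hα : 0 < α) {f : SFT F lam → ℝ}
    (hf : DependsOnFirst N f) : HolderSpace (SFT F lam) α :=
  .ofBounded hα (hf.memHolder α) hf.exists_abs_le

end DependsOnFirst

theorem eventually_exists_dependsOnFirst_norm_sub_lt [Finite S] {α γ : ℝ≥0} (hα : 0 < α)
    (hαγ : α < γ) {A : HolderSpace (SFT F lam) α} (hA : MemHolder γ A) {ε : ℝ} (hε : 0 < ε) :
    ∀ᶠ N in atTop, ∃ B : HolderSpace (SFT F lam) α, DependsOnFirst N B ∧ ‖B - A‖ < ε := by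
  obtain ⟨C, hC⟩ := hA
  have hlim : Tendsto (fun r : ℝ => 2 * C * r ^ ((γ : ℝ) - α) + C * r ^ (γ : ℝ)) (𝓝 0) (𝓝 0) := by
    have hαγ' : (0 : ℝ) < γ - α := sub_pos.2 hαγ
    have hγ : (0 : ℝ) < γ := hα.trans hαγ
    have hcont : Continuous fun r : ℝ => 2 * C * r ^ ((γ : ℝ) - α) + C * r ^ (γ : ℝ) := by
      fun_prop (disch := positivity)
    exact hcont.tendsto' _ _ (by simp [Real.zero_rpow, hαγ'.ne', hγ.ne'])
  have hpow := tendsto_pow_atTop_nhds_zero_of_lt_one lam.2.1.le lam.2.2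
  filter_upwards [(hlim.comp hpow).eventually (gt_mem_nhds hε)] with N hN
  obtain ⟨π, hπ, hπ'⟩ := exists_cylinder_representative (F := F) (lam := lam) N
  have hr : (0 : ℝ) < (lam : ℝ) ^ N := pow_pos lam.2.1 N
  have hdep : DependsOnFirst N fun x => A (π x) := fun x y h =>
    congrArg A (hπ' x y ((dist_le_pow_iff x y N).2 h))
  refine ⟨hdep.toHolderSpace hα, hdep, lt_of_le_of_lt ?_ hN⟩
  refine (HolderSpace.norm_le _ (holderWith_comp_sub hr hαγ.le hC hπ hπ') (by positivity)
    (abs_comp_sub_le_of_dist_le hC hπ)).trans_eq ?_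
  simp [Real.coe_toNNReal _ hr.le]

end DependsOnFirst

section Pressure

variable [Fintype S]

theorem partitionFunction_le {A B : SFT F lam → ℝ} {b c : ℝ} (hB : ∀ x, |B x| ≤ b)
    (h : ∀ x, A x ≤ B x + c) (n : ℕ) :
    partitionFunction A n ≤ Real.exp (n * c) * partitionFunction B n := by
  classical
  rw [partitionFunction, partitionFunction, Finset.mul_sum]
  refine Finset.sum_le_sum fun w hw => ?_
  rw [← Real.exp_add]
  refine Real.exp_le_exp.2 (csSup_le ((Finset.mem_filter.1 hw).2.image _) ?_)
  rintro _ ⟨x, hx, rfl⟩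
  have hbdd : BddAbove ((fun x => birkhoffSum shift B n x) '' cylinder w) :=
    ⟨n * b, by rintro _ ⟨y, _, rfl⟩; exact (abs_le.1 (abs_birkhoffSum_le hB n y)).2⟩
  have hsup := le_csSup hbdd ⟨x, hx, rfl⟩
  have hsum := birkhoffSum_le_birkhoffSum_add (T := shift) h n x
  linarith

theorem partitionFunction_zero (n : ℕ) : partitionFunction (0 : SFT F lam → ℝ) n =
    {w : Fin n → S | (cylinder w : Set (SFT F lam)).Nonempty}.ncard := by
  classical
  have hterm : ∀ w ∈ Finset.univ.filter fun w : Fin n → S =>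
      (cylinder w : Set (SFT F lam)).Nonempty,
      Real.exp (sSup ((fun x => birkhoffSum shift (0 : SFT F lam → ℝ) n x) '' cylinder w)) = 1 := by
    intro w hw
    simp [birkhoffSum, (Finset.mem_filter.1 hw).2.image_const]
  rw [partitionFunction, Finset.sum_congr rfl hterm, Set.ncard_eq_toFinset_card']
  simp

theorem partitionFunction_zero_le (n : ℕ) :
    partitionFunction (0 : SFT F lam → ℝ) n ≤ (Fintype.card S : ℝ) ^ n := by
  rw [partitionFunction_zero]
  have h := Set.ncard_le_card {w : Fin n → S | (cylinder w : Set (SFT F lam)).Nonempty}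
  rw [Nat.card_eq_fintype_card, Fintype.card_fun, Fintype.card_fin] at h
  exact_mod_cast h

variable [Nonempty (SFT F lam)]

theorem partitionFunction_pos (A : SFT F lam → ℝ) (n : ℕ) : 0 < partitionFunction A n := by
  classical
  obtain ⟨x⟩ := ‹Nonempty (SFT F lam)›
  refine Finset.sum_pos (fun w _ => Real.exp_pos _) ⟨fun i => x.1 i, ?_⟩
  exact Finset.mem_filter.2 ⟨Finset.mem_univ _, x, fun i => rfl⟩

theorem one_le_partitionFunction_zero (n : ℕ) :
    1 ≤ partitionFunction (0 : SFT F lam → ℝ) n := by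
  have h := partitionFunction_pos (0 : SFT F lam → ℝ) n
  rw [partitionFunction_zero] at h ⊢
  exact_mod_cast h

theorem log_partitionFunction_div_le {A B : SFT F lam → ℝ} {b c : ℝ} (hB : ∀ x, |B x| ≤ b)
    (h : ∀ x, A x ≤ B x + c) {n : ℕ} (hn : n ≠ 0) :
    Real.log (partitionFunction A n) / n ≤ c + Real.log (partitionFunction B n) / n := by
  have hn' : (0 : ℝ) < n := by positivity
  have hlog := Real.log_le_log (partitionFunction_pos A n) (partitionFunction_le hB h n)
  rw [Real.log_mul (Real.exp_pos _).ne' (partitionFunction_pos B n).ne', Real.log_exp] at hlog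
  rw [div_le_iff₀ hn', add_mul, div_mul_cancel₀ _ hn'.ne']
  linarith

theorem abs_log_partitionFunction_div_le (A : SFT F lam →ᵇ ℝ) {n : ℕ} (hn : n ≠ 0) :
    |Real.log (partitionFunction A n) / n| ≤ ‖A‖ + Real.log (Fintype.card S) := by
  have hn' : (0 : ℝ) < n := by positivity
  have hA := A.norm_coe_le_norm
  have hzero : ∀ x : SFT F lam, |(0 : SFT F lam → ℝ) x| ≤ 0 := by simp
  have hupper := log_partitionFunction_div_le (A := A) hzero (c := ‖A‖)
    (fun x => by simpa using (abs_le.1 (hA x)).2) hn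
  have hlower := log_partitionFunction_div_le (A := 0) hA (c := ‖A‖)
    (fun x => by simpa using neg_le_iff_add_nonneg.1 (abs_le.1 (hA x)).1) hn
  have hcard : Real.log (partitionFunction (0 : SFT F lam → ℝ) n) / n ≤
      Real.log (Fintype.card S) := by
    rw [div_le_iff₀ hn', mul_comm, ← Real.log_pow]
    exact Real.log_le_log (partitionFunction_pos _ n) (partitionFunction_zero_le n)
  have hone : 0 ≤ Real.log (partitionFunction (0 : SFT F lam → ℝ) n) / n :=
    div_nonneg (Real.log_nonneg (one_le_partitionFunction_zero n)) hn'.le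
  rw [abs_le]
  constructor <;> linarith

theorem isBoundedUnder_abs_log_partitionFunction_div (A : SFT F lam →ᵇ ℝ) :
    IsBoundedUnder (· ≤ ·) atTop fun n : ℕ => |Real.log (partitionFunction A n) / n| :=
  ⟨_, eventually_map.2 <| (eventually_ne_atTop 0).mono fun _ hn =>
    abs_log_partitionFunction_div_le A hn⟩

theorem pressure_le_add {A B : SFT F lam →ᵇ ℝ} {c : ℝ} (h : ∀ x, A x ≤ B x + c) :
    pressure A ≤ c + pressure B := by
  have hA := isBoundedUnder_le_abs.1 (isBoundedUnder_abs_log_partitionFunction_div A)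
  have hB := isBoundedUnder_le_abs.1 (isBoundedUnder_abs_log_partitionFunction_div B)
  have hB' (x : SFT F lam) : |B x| ≤ ‖B‖ := B.norm_coe_le_norm x
  rw [pressure, pressure, ← limsup_const_add _ _ c hB.1 hB.2.isCoboundedUnder_le]
  refine limsup_le_limsup ?_ hA.2.isCoboundedUnder_le ?_
  · filter_upwards [eventually_ne_atTop 0] with n hn
    exact log_partitionFunction_div_le (A := ⇑A) (B := ⇑B) hB' h hn
  · exact isBoundedUnder_le_add isBoundedUnder_const hB.1

theorem abs_pressure_sub_le (A B : SFT F lam →ᵇ ℝ) : |pressure A - pressure B| ≤ ‖A - B‖ := by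
  have hAB (x : SFT F lam) := abs_le.1 ((A - B).norm_coe_le_norm x)
  simp only [BoundedContinuousFunction.sub_apply] at hAB
  have h₁ : pressure A ≤ ‖A - B‖ + pressure B := pressure_le_add fun x => by linarith [hAB x]
  have h₂ : pressure B ≤ ‖A - B‖ + pressure A := pressure_le_add fun x => by linarith [hAB x]
  rw [abs_le]
  constructor <;> linarith

theorem pressure_sub_const (A : SFT F lam →ᵇ ℝ) (c : ℝ) :
    pressure ⇑(A - .const _ c) = pressure A - c := by
  have h₁ : pressure ⇑(A - .const _ c) ≤ -c + pressure A :=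
    pressure_le_add fun x => by simp [sub_eq_neg_add]
  have h₂ : pressure A ≤ c + pressure ⇑(A - .const _ c) := pressure_le_add fun x => by simp
  linarith

end Pressure

section Words

variable {N : ℕ}

/-- Words of this length decide membership in the subshift: no pattern of `F` reaches beyond the
first `windowLength F` coordinates. -/
def windowLength (F : Finset (SymbolicDynamics.FullShift.Pattern S ℕ)) : ℕ :=
  (F.sup fun p => p.support.sup id) + 1

theorem mem_forbidden_of_windows (hN : windowLength F ≤ N) {y : ℕ → S}
    (hy : ∀ t, ∃ x : SFT F lam, ∀ r < N, y (t + r) = x.1 r) :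
    y ∈ SymbolicDynamics.FullShift.forbidden
      (F : Set (SymbolicDynamics.FullShift.Pattern S ℕ)) := by
  intro p hp g hocc
  obtain ⟨x, hx⟩ := hy g
  refine x.2 p hp 0 fun h hh => ?_
  have hsupp : h ≤ p.support.sup id := Finset.le_sup (f := id) hh
  have hsup : p.support.sup id ≤ F.sup fun p => p.support.sup id :=
    Finset.le_sup (f := fun p => p.support.sup id) hp
  rw [zero_add, ← hx h (by unfold windowLength at hN; lia)]
  exact hocc h hh

theorem exists_splice (hN : windowLength F ≤ N) {x z : SFT F lam} {i : ℕ}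
    (h : ∀ r < N, x.1 (i + r) = z.1 r) :
    ∃ y : SFT F lam, (∀ t < i + N, y.1 t = x.1 t) ∧ shift^[i] y = z := by
  let s (t : ℕ) : S := if t < i then x.1 t else z.1 (t - i)
  have hsx : ∀ t < i + N, s t = x.1 t := fun t ht => by
    by_cases hti : t < i
    · exact if_pos hti
    · rw [show s t = z.1 (t - i) from if_neg hti, ← h _ (by lia), Nat.add_sub_cancel' (by lia)]
  have hsz : ∀ t, s (t + i) = z.1 t := fun t => by simp [s]
  refine ⟨⟨s, mem_forbidden_of_windows (lam := lam) hN fun t => ?_⟩, hsx,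
    ext_apply fun t => (shift_iterate_apply ..).trans (hsz t)⟩
  rcases lt_or_ge t i with hti | hti
  · refine ⟨shift^[t] x, fun r hr => ?_⟩
    rw [shift_iterate_apply, hsx _ (by lia), add_comm]
  · refine ⟨shift^[t - i] z, fun r _ => ?_⟩
    rw [shift_iterate_apply, ← hsz]
    exact congrArg s (by lia)

theorem exists_isPeriodicPt_of_repeat (hN : windowLength F ≤ N) {x : SFT F lam} {q : ℕ}
    (hq : 0 < q) (h : ∀ r < N, x.1 r = x.1 (q + r)) :
    ∃ p : SFT F lam, Function.IsPeriodicPt shift q p ∧ ∀ t < q + N, p.1 t = x.1 t := by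
  have hmod : ∀ t < q + N, x.1 (t % q) = x.1 t := by
    intro t
    induction t using Nat.strong_induction_on with
    | _ t ih =>
      intro ht
      rcases lt_or_ge t q with htq | htq
      · rw [Nat.mod_eq_of_lt htq]
      · rw [Nat.mod_eq_sub_mod htq, ih (t - q) (by lia) (by lia), h (t - q) (by lia),
          Nat.add_sub_cancel' htq]
  refine ⟨⟨fun t => x.1 (t % q), mem_forbidden_of_windows (lam := lam) hN fun t => ?_⟩,
    ext_apply fun t => (shift_iterate_apply ..).trans (congrArg x.1 (Nat.add_mod_right t q)), hmod⟩
  refine ⟨shift^[t % q] x, fun r hr => ?_⟩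
  have := Nat.mod_lt t hq
  rw [shift_iterate_apply, ← Nat.mod_add_mod, hmod _ (by lia), add_comm]

/-- The segment between two occurrences of a word of length `N` is cut out of `x`, leaving `y`, and
closed up to the periodic point `p`. -/
theorem exists_cut (hN : windowLength F ≤ N) {x : SFT F lam} {i q : ℕ} (hq : 0 < q)
    (h : ∀ r < N, x.1 (i + r) = x.1 (i + q + r)) {A : SFT F lam → ℝ} (hA : DependsOnFirst N A) :
    ∃ p y : SFT F lam, Function.IsPeriodicPt shift q p ∧ ∀ n,
      birkhoffSum shift A (i + q + n) x =
        birkhoffSum shift A (i + n) y + birkhoffSum shift A q p := by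
  obtain ⟨y, hyx, hy⟩ := exists_splice hN (z := shift^[i + q] x) (x := x) (i := i) fun r hr => by
    rw [shift_iterate_apply, h r hr, add_comm]
  obtain ⟨p, hp, hpx⟩ := exists_isPeriodicPt_of_repeat hN (x := shift^[i] x) hq fun r hr => by
    rw [shift_iterate_apply, shift_iterate_apply, add_comm, h r hr]
    exact congrArg x.1 (by lia)
  refine ⟨p, y, hp, fun n => ?_⟩
  rw [birkhoffSum_add, birkhoffSum_add, birkhoffSum_add, hy, hA.birkhoffSum_eq hyx,
    hA.birkhoffSum_eq hpx]
  ring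

theorem finite_ptsOfPeriod [Finite S] {q : ℕ} (hq : 0 < q) :
    (Function.ptsOfPeriod (shift : SFT F lam → SFT F lam) q).Finite := by
  refine Set.Finite.of_injOn (f := fun x (i : Fin q) => x.1 i) (Set.mapsTo_univ _ _)
    (fun x hx y hy hxy => ext_apply fun t => ?_) Set.finite_univ
  rw [← (periodic_apply hx).map_mod_nat t, ← (periodic_apply hy).map_mod_nat t]
  exact congrFun hxy ⟨t % q, Nat.mod_lt t hq⟩

end Words

section MaximizingPeriodicOrbit

variable {N : ℕ}

/-- Cutting out repeated words reduces any orbit segment to one of length at most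
`Fintype.card S ^ N`. -/
theorem birkhoffSum_le_of_birkhoffAverage_le [Fintype S] (hN : windowLength F ≤ N)
    {A : SFT F lam → ℝ} (hA : DependsOnFirst N A) {b m : ℝ} (hb : ∀ x, |A x| ≤ b)
    (hm : ∀ q p, 0 < q → q ≤ Fintype.card S ^ N → Function.IsPeriodicPt shift q p →
      birkhoffAverage ℝ shift A q p ≤ m) (n : ℕ) (x : SFT F lam) :
    birkhoffSum shift A n x ≤ n * m + Fintype.card S ^ N * (b + |m|) := by
  induction n using Nat.strong_induction_on generalizing x with
  | _ n ih =>
    rcases le_or_gt n (Fintype.card S ^ N) with hn | hn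
    · have hsum := (abs_le.1 (abs_birkhoffSum_le (T := shift) hb n x)).2
      have hb0 : 0 ≤ b := (abs_nonneg _).trans (hb x)
      have hn' : (n : ℝ) ≤ Fintype.card S ^ N := by exact_mod_cast hn
      calc birkhoffSum shift A n x ≤ n * m + n * (b - m) := by linarith
        _ ≤ n * m + n * (b + |m|) := by gcongr; linarith [neg_abs_le m]
        _ ≤ n * m + Fintype.card S ^ N * (b + |m|) := by gcongr
    · obtain ⟨i, q, hq, hiq, hrep⟩ := exists_repeated_word x.1 N
      obtain ⟨p, y, hp, hcut⟩ := exists_cut hN hq hrep hA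
      obtain ⟨k, rfl⟩ := Nat.exists_eq_add_of_le (hiq.trans hn.le)
      have hy := ih (i + k) (by lia) y
      have hpm := mul_le_mul_of_nonneg_left (hm q p hq (by lia) hp) q.cast_nonneg
      rw [natCast_mul_birkhoffAverage] at hpm
      rw [hcut]
      push_cast at hy ⊢
      linarith

theorem exists_periodic_birkhoffSum_le [Finite S] [Nonempty (SFT F lam)] (hN : windowLength F ≤ N)
    {A : SFT F lam → ℝ} (hA : DependsOnFirst N A) :
    ∃ (q : ℕ) (p : SFT F lam), 0 < q ∧ Function.IsPeriodicPt shift q p ∧ ∃ C, ∀ n x,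
      birkhoffSum shift A n x ≤ n * birkhoffAverage ℝ shift A q p + C := by
  have := Fintype.ofFinite S
  let orbits : Set (ℕ × SFT F lam) :=
    ⋃ q ∈ Set.Icc 1 (Fintype.card S ^ N), Prod.mk q '' Function.ptsOfPeriod shift q
  have hmem (z : ℕ × SFT F lam) : z ∈ orbits ↔
      (0 < z.1 ∧ z.1 ≤ Fintype.card S ^ N) ∧ Function.IsPeriodicPt shift z.1 z.2 := by
    obtain ⟨q, p⟩ := z
    simp [orbits, Function.mem_ptsOfPeriod, Nat.one_le_iff_ne_zero, Nat.pos_iff_ne_zero, and_comm]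
  have hfin : orbits.Finite := (Set.finite_Icc 1 _).biUnion fun q hq =>
    (finite_ptsOfPeriod hq.1).image _
  have hne : orbits.Nonempty := by
    obtain ⟨x⟩ := ‹Nonempty (SFT F lam)›
    obtain ⟨i, q, hq, hiq, hrep⟩ := exists_repeated_word x.1 N
    obtain ⟨p, -, hp, -⟩ := exists_cut hN hq hrep hA
    exact ⟨(q, p), (hmem _).2 ⟨⟨hq, by lia⟩, hp⟩⟩
  obtain ⟨⟨q, p⟩, hqp, hmax⟩ :=
    Set.exists_max_image orbits (fun z => birkhoffAverage ℝ shift A z.1 z.2) hfin hne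
  obtain ⟨⟨hq, -⟩, hp⟩ := (hmem _).1 hqp
  obtain ⟨b, hb⟩ := hA.exists_abs_le
  exact ⟨q, p, hq, hp, _, birkhoffSum_le_of_birkhoffAverage_le hN hA hb
    fun q' p' hq' hqN hp' => hmax (q', p') ((hmem _).2 ⟨⟨hq', hqN⟩, hp'⟩)⟩

end MaximizingPeriodicOrbit

section OrbitNhd

/-- The points that share their first `q + 1` coordinates with some point of the orbit of `p`. -/
def orbitNhd (p : SFT F lam) (q : ℕ) : Set (SFT F lam) :=
  {x | ∃ i, ∀ t ≤ q, x.1 t = p.1 (i + t)}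

theorem dependsOnFirst_orbitNhd (p : SFT F lam) (q : ℕ) :
    DependsOnFirst (q + 1) (· ∈ orbitNhd p q) := fun x y h => by
  refine propext (exists_congr fun i => forall₂_congr fun t ht => ?_)
  rw [h t (by lia)]

theorem measurableSet_orbitNhd (p : SFT F lam) (q : ℕ) : MeasurableSet (orbitNhd p q) :=
  (dependsOnFirst_orbitNhd p q).isOpen.measurableSet

theorem dependsOnFirst_indicator_compl_orbitNhd (p : SFT F lam) (q : ℕ) :
    DependsOnFirst (q + 1) ((orbitNhd p q)ᶜ.indicator (1 : SFT F lam → ℝ)) :=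
  .indicator_one fun x y h => congrArg Not (dependsOnFirst_orbitNhd p q x y h)

theorem iterate_mem_orbitNhd (p : SFT F lam) (q k : ℕ) : shift^[k] p ∈ orbitNhd p q :=
  ⟨k, fun t _ => by rw [shift_iterate_apply, add_comm]⟩

theorem birkhoffSum_indicator_compl_orbitNhd (p : SFT F lam) (q n : ℕ) :
    birkhoffSum shift ((orbitNhd p q)ᶜ.indicator (1 : SFT F lam → ℝ)) n p = 0 :=
  Finset.sum_eq_zero fun k _ =>
    Set.indicator_of_notMem (Set.notMem_compl_iff.2 (iterate_mem_orbitNhd p q k)) _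

variable {p : SFT F lam} {q : ℕ}

/-- The condition `shift^[K] x ∈ orbitNhd p q` says that the coordinates `K` and `K + q` of `x`
agree, so a point that stays in `orbitNhd p q` continues with period `q`. -/
theorem apply_eq_of_forall_mem_orbitNhd (hq : 0 < q) (hp : Function.IsPeriodicPt shift q p)
    {x : SFT F lam} {i K : ℕ} (hi : ∀ t ≤ q, x.1 t = p.1 (i + t))
    (hK : ∀ k < K, shift^[k] x ∈ orbitNhd p q) : ∀ t < K + q, x.1 t = p.1 (i + t) := by
  have hper := periodic_apply hp
  induction K with
  | zero => exact fun t ht => hi t (by lia)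
  | succ K ih =>
    intro t ht
    have ih := ih fun k hk => hK k (by lia)
    rcases (show t ≤ K + q by lia).lt_or_eq with htK | rfl
    · exact ih t htK
    obtain ⟨j, hj⟩ := hK K (by lia)
    have h₀ := hj 0 (by lia)
    have hjq := hj q le_rfl
    rw [shift_iterate_apply] at h₀ hjq
    calc x.1 (K + q) = p.1 (j + q) := by rw [add_comm, hjq]
      _ = x.1 K := by rw [hper, ← zero_add K, h₀, add_zero]
      _ = p.1 (i + (K + q)) := by rw [ih K (by lia), ← add_assoc, hper]

theorem eq_orbitMeasure_of_ae_mem_orbitNhd (hq : 0 < q) (hp : Function.IsPeriodicPt shift q p)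
    {ν : Measure (SFT F lam)} [IsProbabilityMeasure ν] (hν : MeasurePreserving shift ν ν)
    (h : ∀ᵐ x ∂ν, x ∈ orbitNhd p q) : ν = orbitMeasure shift p q := by
  have hall : ∀ᵐ x ∂ν, ∀ k, shift^[k] x ∈ orbitNhd p q :=
    ae_all_iff.2 fun k => (hν.iterate k).quasiMeasurePreserving.ae h
  refine eq_orbitMeasure_of_ae_mem_orbit hq hp hν ?_
  filter_upwards [hall] with x hx
  obtain ⟨i, hi⟩ := hx 0
  refine ⟨i, ext_apply fun t => ?_⟩
  rw [shift_iterate_apply, add_comm]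
  exact apply_eq_of_forall_mem_orbitNhd hq hp hi (K := t + 1) (fun k _ => hx k) t (by lia)

end OrbitNhd

section HolderBirkhoffSum

variable {α : ℝ≥0} {p : SFT F lam} {q : ℕ}

theorem abs_birkhoffSum_sub_le_of_forall_lt (hα : 0 < α) (g : HolderSpace (SFT F lam) α)
    {x y : SFT F lam} {K : ℕ} (h : ∀ t < K, x.1 t = y.1 t) :
    |birkhoffSum shift g K x - birkhoffSum shift g K y| ≤ ‖g‖ * (1 - (lam : ℝ) ^ (α : ℝ))⁻¹ := by
  set r : ℝ := (lam : ℝ) ^ (α : ℝ) with hr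
  have hr0 : 0 ≤ r := Real.rpow_nonneg lam.2.1.le _
  have hr1 : r < 1 := Real.rpow_lt_one lam.2.1.le lam.2.2 hα
  have hterm : ∀ k ∈ Finset.range K,
      dist (g (shift^[k] x)) (g (shift^[k] y)) ≤ ‖g‖ * r ^ (K - 1 - k) := fun k _ => by
    have hdist : dist (shift^[k] x) (shift^[k] y) ≤ (lam : ℝ) ^ (K - 1 - k) := by
      refine (dist_le_pow_iff _ _ _).2 fun t ht => ?_
      rw [shift_iterate_apply, shift_iterate_apply, h _ (by lia)]
    calc dist (g (shift^[k] x)) (g (shift^[k] y))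
        ≤ ‖g‖ * dist (shift^[k] x) (shift^[k] y) ^ (α : ℝ) := g.abs_sub_apply_le _ _
      _ ≤ ‖g‖ * ((lam : ℝ) ^ (K - 1 - k)) ^ (α : ℝ) := by gcongr
      _ = ‖g‖ * r ^ (K - 1 - k) := by rw [hr, Real.rpow_pow_comm lam.2.1.le]
  calc |birkhoffSum shift g K x - birkhoffSum shift g K y|
      ≤ ∑ k ∈ Finset.range K, dist (g (shift^[k] x)) (g (shift^[k] y)) :=
        (Real.dist_eq _ _).symm.trans_le (dist_birkhoffSum_birkhoffSum_le ..)
    _ ≤ ∑ k ∈ Finset.range K, ‖g‖ * r ^ (K - 1 - k) := Finset.sum_le_sum hterm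
    _ = ‖g‖ * ∑ k ∈ Finset.range K, r ^ k := by
        rw [← Finset.mul_sum, Finset.sum_range_reflect (fun k => r ^ k) K]
    _ ≤ ‖g‖ * (1 - r)⁻¹ := by
        gcongr
        exact sum_le_hasSum _ (fun k _ => pow_nonneg hr0 k) (hasSum_geometric_of_lt_one hr0 hr1)

/-- Up to the factor `‖g‖`, this bounds the difference between a Birkhoff sum of a Hölder function
`g` along an orbit segment in `orbitNhd p q` and the length of the segment times the mean of `g`
over the orbit of `p`. -/
noncomputable def shadowingConst (lam : Set.Ioo (0 : ℝ) 1) (α : ℝ≥0) (q : ℕ) : ℝ :=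
  (1 - (lam : ℝ) ^ (α : ℝ))⁻¹ + 2 * q

theorem birkhoffSum_le_of_forall_mem_orbitNhd (hq : 0 < q) (hp : Function.IsPeriodicPt shift q p)
    (hα : 0 < α) (g : HolderSpace (SFT F lam) α) {x : SFT F lam} {K : ℕ}
    (hK : ∀ k < K, shift^[k] x ∈ orbitNhd p q) :
    birkhoffSum shift g K x ≤
      K * birkhoffAverage ℝ shift g q p + ‖g‖ * shadowingConst lam α q := by
  obtain ⟨i, hi⟩ : ∃ i, ∀ t < K, x.1 t = (shift^[i] p).1 t := by
    rcases K.eq_zero_or_pos with rfl | hK0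
    · exact ⟨0, fun t ht => absurd ht t.not_lt_zero⟩
    · obtain ⟨i, hi⟩ := hK 0 hK0
      refine ⟨i, fun t ht => ?_⟩
      rw [shift_iterate_apply, add_comm]
      exact apply_eq_of_forall_mem_orbitNhd hq hp hi hK t (by lia)
  have hshadow := (abs_le.1 (abs_birkhoffSum_sub_le_of_forall_lt hα g hi)).2
  have hperiodic := (abs_le.1
    (abs_birkhoffSum_iterate_sub_le_of_isPeriodicPt hq hp g.abs_apply_le_norm i K)).2
  rw [shadowingConst]
  linarith

theorem birkhoffSum_le_add_birkhoffSum_indicator (hq : 0 < q)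
    (hp : Function.IsPeriodicPt shift q p) (hα : 0 < α) (g : HolderSpace (SFT F lam) α) (n : ℕ)
    (x : SFT F lam) :
    birkhoffSum shift g n x ≤ n * birkhoffAverage ℝ shift g q p +
      ‖g‖ * (shadowingConst lam α q + 2) *
        birkhoffSum shift ((orbitNhd p q)ᶜ.indicator 1) n x + ‖g‖ * shadowingConst lam α q := by
  have havg := (abs_le.1 (abs_birkhoffAverage_le (T := shift) g.abs_apply_le_norm q p)).1
  rw [mul_add]
  refine birkhoffSum_le_of_forall_notMem (fun x => ?_) (fun x n h => ?_) n x
  · linarith [(abs_le.1 (g.abs_apply_le_norm x)).2]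
  · exact birkhoffSum_le_of_forall_mem_orbitNhd hq hp hα g fun k hk => not_not.1 (h k hk)

end HolderBirkhoffSum

section Locking

variable {p : SFT F lam} {q : ℕ}

/-- The periodic orbit of `p` maximizes the Birkhoff sums of `f` up to a bounded error, and every
visit to the complement of its neighbourhood `orbitNhd p q` costs at least a fixed amount. -/
def IsLockedOn (p : SFT F lam) (q : ℕ) (f : SFT F lam → ℝ) : Prop :=
  ∃ ε > 0, ∃ C, ∀ n x, birkhoffSum shift f n x ≤ n * birkhoffAverage ℝ shift f q p -
    ε * birkhoffSum shift ((orbitNhd p q)ᶜ.indicator 1) n x + C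

namespace IsLockedOn

theorem eventually {α : ℝ≥0} (hα : 0 < α) (hq : 0 < q) (hp : Function.IsPeriodicPt shift q p)
    {B : HolderSpace (SFT F lam) α} (hB : IsLockedOn p q B) :
    ∀ᶠ A : HolderSpace (SFT F lam) α in 𝓝 B, IsLockedOn p q A := by
  obtain ⟨ε, hε, C, h⟩ := hB
  have hcont : Continuous fun A : HolderSpace (SFT F lam) α =>
      ‖A - B‖ * (shadowingConst lam α q + 2) := by fun_prop
  filter_upwards [hcont.tendsto' B 0 (by simp) |>.eventually (gt_mem_nhds hε)] with A hA
  refine ⟨ε - ‖A - B‖ * (shadowingConst lam α q + 2), sub_pos.2 hA,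
    C + ‖A - B‖ * shadowingConst lam α q, fun n x => ?_⟩
  have hAB : (A : SFT F lam → ℝ) = B + ((A - B : HolderSpace (SFT F lam) α) : SFT F lam → ℝ) :=
    funext fun x => (add_sub_cancel (B x) (A x)).symm
  have hperturbation := birkhoffSum_le_add_birkhoffSum_indicator hq hp hα (A - B) n x
  rw [hAB, birkhoffSum_add', birkhoffAverage_add, Pi.add_apply, Pi.add_apply]
  linarith [h n x]

theorem sub_const (hq : 0 < q) {f : SFT F lam → ℝ} (hf : IsLockedOn p q f) (c : ℝ) :
    IsLockedOn p q fun x => f x - c := by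
  have hsum (n : ℕ) (x : SFT F lam) :
      birkhoffSum shift (fun x => f x - c) n x = birkhoffSum shift f n x - n * c := by
    simp [birkhoffSum, Finset.sum_sub_distrib]
  have havg : birkhoffAverage ℝ shift (fun x => f x - c) q p =
      birkhoffAverage ℝ shift f q p - c := by
    have hq' : (q : ℝ) ≠ 0 := Nat.cast_ne_zero.2 hq.ne'
    refine mul_left_cancel₀ hq' ?_
    rw [natCast_mul_birkhoffAverage, hsum, mul_sub, natCast_mul_birkhoffAverage]
  obtain ⟨ε, hε, C, h⟩ := hf
  refine ⟨ε, hε, C, fun n x => ?_⟩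
  rw [hsum, havg]
  linarith [h n x]

theorem isMaximizingMeasure_iff (hq : 0 < q) (hp : Function.IsPeriodicPt shift q p)
    {f : SFT F lam →ᵇ ℝ} (hf : IsLockedOn p q f) (μ : ProbabilityMeasure (SFT F lam)) :
    IsMaximizingMeasure f μ ↔ (μ : Measure (SFT F lam)) = orbitMeasure shift p q := by
  have hshift : Measurable (shift : SFT F lam → SFT F lam) := continuous_shift.measurable
  obtain ⟨ε, hε, C, h⟩ := hf
  have hle (ν : Measure (SFT F lam)) [IsProbabilityMeasure ν] (hν : MeasurePreserving shift ν ν) :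
      ∫ x, f x ∂ν + ε * ν.real (orbitNhd p q)ᶜ ≤ birkhoffAverage ℝ shift f q p :=
    integral_add_mul_measureReal_le_of_birkhoffSum_le hν (f.integrable _)
      (measurableSet_orbitNhd p q).compl h
  constructor
  · rintro ⟨hμ, hmax⟩
    have horbit := hmax ⟨_, isProbabilityMeasure_orbitMeasure shift p hq⟩
      (measurePreserving_orbitMeasure hshift hp)
    rw [ProbabilityMeasure.coe_mk, integral_orbitMeasure] at horbit
    have hcost : ε * (μ : Measure (SFT F lam)).real (orbitNhd p q)ᶜ ≤ 0 := by
      linarith [hle (μ : Measure (SFT F lam)) hμ]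
    have hzero : (μ : Measure (SFT F lam)).real (orbitNhd p q)ᶜ = 0 :=
      le_antisymm (nonpos_of_mul_nonpos_right hcost hε) measureReal_nonneg
    exact eq_orbitMeasure_of_ae_mem_orbitNhd hq hp hμ ((measureReal_eq_zero_iff).1 hzero)
  · intro hμ
    rw [IsMaximizingMeasure, hμ, integral_orbitMeasure]
    refine ⟨measurePreserving_orbitMeasure hshift hp, fun ν hν => ?_⟩
    have hpos : 0 ≤ ε * (ν : Measure (SFT F lam)).real (orbitNhd p q)ᶜ := by positivity
    linarith [hle (ν : Measure (SFT F lam)) hν]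

theorem exists_hasContinuouslyVaryingSupport [Fintype S] {α : ℝ≥0} (hα : 0 < α) (hq : 0 < q)
    (hp : Function.IsPeriodicPt shift q p) {B : HolderSpace (SFT F lam) α}
    (hB : IsLockedOn p q B) :
    ∃ μ : ProbabilityMeasure (SFT F lam),
      IsMaximizingMeasure B μ ∧ (∀ ν, IsMaximizingMeasure B ν → ν = μ) ∧
      HasContinuouslyVaryingSupport B μ := by
  let μ : ProbabilityMeasure (SFT F lam) := ⟨_, isProbabilityMeasure_orbitMeasure shift p hq⟩
  have hiff {A : HolderSpace (SFT F lam) α} (hA : IsLockedOn p q A)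
      (ν : ProbabilityMeasure (SFT F lam)) : IsMaximizingMeasure A ν ↔ ν = μ :=
    (hA.isMaximizingMeasure_iff (f := A.1) hq hp ν).trans
      ⟨fun h => Subtype.ext h, congrArg Subtype.val⟩
  refine ⟨μ, (hiff hB μ).2 rfl, fun ν => (hiff hB ν).1, fun An μn _ hAn hμn => ?_⟩
  have heq : ∀ᶠ n in atTop, μ = μn n :=
    (hAn.eventually (hB.eventually hα hq hp)).mono fun n hn => ((hiff hn _).1 (hμn n)).symm
  refine ⟨tendsto_const_nhds.congr' heq, tendsto_const_nhds.congr' ?_⟩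
  filter_upwards [heq] with n hn
  rw [← hn, Metric.hausdorffEDist_self]

end IsLockedOn

theorem exists_isLockedOn_sub_smul_indicator [Finite S] [Nonempty (SFT F lam)] {N : ℕ}
    (hN : windowLength F ≤ N) {A : SFT F lam → ℝ} (hA : DependsOnFirst N A) :
    ∃ (q : ℕ) (p : SFT F lam), 0 < q ∧ Function.IsPeriodicPt shift q p ∧
      ∀ ε > 0, IsLockedOn p q fun x => A x - ε * (orbitNhd p q)ᶜ.indicator 1 x := by
  obtain ⟨q, p, hq, hp, C, h⟩ := exists_periodic_birkhoffSum_le hN hA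
  refine ⟨q, p, hq, hp, fun ε hε => ⟨ε, hε, C, fun n x => ?_⟩⟩
  have hsum (n : ℕ) (x : SFT F lam) :
      birkhoffSum shift (fun x => A x - ε * (orbitNhd p q)ᶜ.indicator 1 x) n x =
        birkhoffSum shift A n x - ε * birkhoffSum shift ((orbitNhd p q)ᶜ.indicator 1) n x := by
    simp only [birkhoffSum, Finset.sum_sub_distrib, Finset.mul_sum]
  have havg : birkhoffAverage ℝ shift (fun x => A x - ε * (orbitNhd p q)ᶜ.indicator 1 x) q p =
      birkhoffAverage ℝ shift A q p := by
    rw [birkhoffAverage, hsum, birkhoffSum_indicator_compl_orbitNhd, mul_zero, sub_zero,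
      birkhoffAverage]
  rw [hsum, havg]
  linarith [h n x]

end Locking

section Density

variable [Nonempty (SFT F lam)] {α γ : ℝ≥0}

theorem norm_sub_const_pressure_sub_le [Fintype S] {A : HolderSpace (SFT F lam) α}
    (hA : pressure A = 0) (B : HolderSpace (SFT F lam) α) :
    ‖B - HolderSpace.const _ α (pressure B) - A‖ ≤ 2 * ‖B - A‖ := by
  have hpressure : |pressure B| ≤ ‖B - A‖ := by
    have h := (abs_pressure_sub_le B.1 A.1).trans (B - A).norm_coe_le_norm
    rwa [hA, sub_zero] at h
  have hconst := HolderSpace.norm_const_le (X := SFT F lam) (α := α) (pressure B)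
  calc ‖B - HolderSpace.const _ α (pressure B) - A‖
      = ‖(B - A) - HolderSpace.const _ α (pressure B)‖ := by rw [sub_right_comm]
    _ ≤ ‖B - A‖ + ‖HolderSpace.const (SFT F lam) α (pressure B)‖ := norm_sub_le _ _
    _ ≤ 2 * ‖B - A‖ := by linarith

theorem exists_dependsOnFirst_isLockedOn_norm_sub_lt [Finite S] (hα : 0 < α) (hαγ : α < γ)
    {A : HolderSpace (SFT F lam) α} (hA : MemHolder γ A) {ε : ℝ} (hε : 0 < ε) :
    ∃ (B : HolderSpace (SFT F lam) α) (N q : ℕ) (p : SFT F lam), DependsOnFirst N B ∧ 0 < q ∧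
      Function.IsPeriodicPt shift q p ∧ IsLockedOn p q B ∧ ‖B - A‖ < ε := by
  obtain ⟨N, ⟨A', hA', hdist⟩, hN⟩ :=
    ((eventually_exists_dependsOnFirst_norm_sub_lt hα hαγ hA hε).and
      (eventually_ge_atTop (windowLength F))).exists
  obtain ⟨q, p, hq, hp, hlocked⟩ := exists_isLockedOn_sub_smul_indicator hN hA'
  have hind := dependsOnFirst_indicator_compl_orbitNhd p q
  let D : HolderSpace (SFT F lam) α := hind.toHolderSpace hα
  have hcont : Continuous fun t : ℝ => ‖A' - t • D - A‖ := by fun_prop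
  have hsmall : ∀ᶠ t : ℝ in 𝓝[>] 0, ‖A' - t • D - A‖ < ε :=
    ((hcont.tendsto 0).mono_left nhdsWithin_le_nhds).eventually
      (gt_mem_nhds (by simpa using hdist))
  obtain ⟨t, htε, ht⟩ := (hsmall.and self_mem_nhdsWithin).exists
  refine ⟨A' - t • D, max N (q + 1), q, p, fun x y hxy => ?_, hq, hp, hlocked t ht, htε⟩
  exact congrArg₂ (fun a d : ℝ => a - t * d) (hA'.mono (le_max_left _ _) x y hxy)
    (hind.mono (le_max_right _ _) x y hxy)

theorem exists_zeroPressure_isLockedOn_norm_sub_lt [Fintype S] (hα : 0 < α) (hαγ : α < γ)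
    {A : HolderSpace (SFT F lam) α} (hA₀ : pressure A = 0) (hA : MemHolder γ A) {ε : ℝ}
    (hε : 0 < ε) :
    ∃ (B : HolderSpace (SFT F lam) α) (q : ℕ) (p : SFT F lam), pressure B = 0 ∧
      (∀ β : ℝ≥0, MemHolder β B) ∧ 0 < q ∧ Function.IsPeriodicPt shift q p ∧ IsLockedOn p q B ∧
      ‖B - A‖ < ε := by
  obtain ⟨B, N, q, p, hB, hq, hp, hlocked, hBA⟩ :=
    exists_dependsOnFirst_isLockedOn_norm_sub_lt hα hαγ hA (half_pos hε)
  refine ⟨B - .const _ α (pressure B), q, p, ?_, ?_, hq, hp, hlocked.sub_const hq _, ?_⟩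
  · exact (pressure_sub_const B.1 _).trans (sub_self _)
  · have hdep : DependsOnFirst N fun x => B x - pressure B := fun x y h =>
      congrArg (· - pressure B) (hB x y h)
    exact hdep.memHolder
  · linarith [norm_sub_const_pressure_sub_le hA₀ B]

end Density

end SFT

theorem theoremC_general {S : Type*} [Fintype S] [Inhabited S]
    (F : Finset (SymbolicDynamics.FullShift.Pattern S ℕ)) (lam : Set.Ioo (0 : ℝ) 1)
    (hne : Nonempty (SFT F lam)) (α : ℝ≥0) (hα : 0 < α) :
    ∃ D : Set (HolderSpace (SFT F lam) α),
      D ⊆ zeroPressurePlus F lam α ∧ zeroPressurePlus F lam α ⊆ closure D ∧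
      ∀ A ∈ D, ∃ μ : ProbabilityMeasure (SFT F lam),
        IsMaximizingMeasure A μ ∧ (∀ ν, IsMaximizingMeasure A ν → ν = μ) ∧
        HasContinuouslyVaryingSupport A μ := by
  refine ⟨{A ∈ zeroPressurePlus F lam α | ∃ (q : ℕ) (p : SFT F lam), 0 < q ∧
    Function.IsPeriodicPt SFT.shift q p ∧ SFT.IsLockedOn p q A}, Set.sep_subset _ _, ?_, ?_⟩
  · refine closure_minimal ?_ isClosed_closure
    rintro A ⟨hA₀, γ, hαγ, hA⟩
    refine Metric.mem_closure_iff.2 fun ε hε => ?_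
    obtain ⟨B, q, p, hB₀, hB, hq, hp, hlocked, hBA⟩ :=
      SFT.exists_zeroPressure_isLockedOn_norm_sub_lt hα hαγ hA₀ hA hε
    refine ⟨B, ⟨subset_closure ⟨hB₀, α + 1, lt_add_one α, hB _⟩, q, p, hq, hp, hlocked⟩, ?_⟩
    rwa [dist_comm, dist_eq_norm]
  · rintro A ⟨-, q, p, hq, hp, hlocked⟩
    exact hlocked.exists_hasContinuouslyVaryingSupport hα hq hp

theorem theoremC {S : Type*} [Fintype S] [Inhabited S]
    (F : Finset (SymbolicDynamics.FullShift.Pattern S ℕ)) (lam : Set.Ioo (0 : ℝ) 1)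
    (hne : Nonempty (SFT F lam))
    (hmix : IsTopologicallyMixing (SFT.shift : SFT F lam → SFT F lam))
    (α : ℝ≥0) (hα : 0 < α) (hα1 : α ≤ 1) :
    ∃ D : Set (HolderSpace (SFT F lam) α),
      D ⊆ zeroPressurePlus F lam α ∧ zeroPressurePlus F lam α ⊆ closure D ∧
      ∀ A ∈ D, ∃ μ : ProbabilityMeasure (SFT F lam),
        IsMaximizingMeasure A μ ∧ (∀ ν, IsMaximizingMeasure A ν → ν = μ) ∧
        HasContinuouslyVaryingSupport A μ :=
  theoremC_general F lam hne α hα
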